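/- Let $A,B$ be finite-dimensional quantum systems (complex Hilbert spaces with fixed orthonormal bases, $\dim A\ge 1$), let $\mathbb L(\cdot)$ denote the linear operators and $\mathbb D(\cdot)$ the density operators (positive semidefinite, trace one) on a system. A linear map $\Phi:\mathbb L(A)\to\mathbb L(B)$ is Hermiticity-preserving if it maps Hermitian operators to Hermitian operators, completely positive (CP) if $\mathrm{id}_A\otimes\Phi$ maps positive semidefinite operators to positive semidefinite operators, and CPTNI if it is CP and $\operatorname{Tr}\Phi(X)\le\operatorname{Tr}X$ for all $X\ge 0$. Let $J_\Phi=(\mathrm{id}_A\otimes\Phi)\big(\sum_{i,j}|ii\rangle\langle jj|\big)$ be the Choi operator of $\Phi$, let $\operatorname{Tr}_B$ be the partial trace over $B$, and let $\lambda_{\min},\lambda_{\max}$ denote the smallest and the largest eigenvalue of a Hermitian operator. Define \[ \begin{aligned} \|\Phi\|_\diamond&=\max\{\|(\mathrm{id}_A\otimes\Phi)(\rho)\|_1 : \rho\in\mathbb D(A\otimes A)\},\\ \|\Phi\|_{\blacklozenge}&=\min\{\lambda_++\lambda_- : \Phi=\lambda_+\Lambda_+-\lambda_-\Lambda_-,\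 \lambda_\pm\ge 0,\ \Lambda_\pm\in\mathrm{CPTNI}\},\\ R'(\Phi)&=\min\{\lambda : J_\Phi\le(1+\lambda)J_\Lambda,\ 1+\lambda\ge 0,\ \Lambda\in\mathrm{CPTNI}\},\\ R''(\Phi)&=\min\{\lambda : \Phi+\lambda\Lambda\in\mathrm{CP},\ \lambda\ge 0,\ \Lambda\in\mathrm{CPTNI}\}, \end{aligned} \] where $\|\cdot\|_1$ is the trace norm. Then for every Hermiticity-preserving linear map $\Phi:\mathbb L(A)\to\mathbb L(B)$ the maximum and the three minima are attained, and \[ \begin{aligned} 2\|\Phi\|_\diamond&\ \ge\ \|\Phi\|_{\blacklozenge}\ \ge\ \|\Phi\|_\diamond,\\ \|\Phi\|_\diamond+1&\ \ge\ R'(\Phi)\ \ge\ \tfrac12\big(\|\Phi\|_\diamond-2+\lambda_{\min}(\operatorname{Tr}_BJ_\Phi)\big),\\ \|\Phi\|_\diamond&\ \ge\ R''(\Phi)\ \ge\ \tfrac12\big(\|\Phi\|_\diamond-\lambda_{\max}(\operatorname{Tr}_BJ_\Phi)\big). \end{aligned} \] -/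

import Mathlib

/-! Linear maps `L(A) → L(B)` between operator spaces of finite-dimensional quantum systems.
A system with a fixed orthonormal basis indexed by a finite type `A` has `L(A) = Matrix A A ℂ`. -/

noncomputable section

open scoped ComplexOrder

namespace QuantumMap

variable {A B : Type*} [Fintype A] [DecidableEq A] [Fintype B] [DecidableEq B]

/-- Density operators: positive semidefinite with unit trace. -/
def IsDensity (ρ : Matrix A A ℂ) : Prop := ρ.PosSemidef ∧ ρ.trace = 1

/-- The trace norm (Schatten 1-norm): the sum of the singular values of `X`, i.e. of the square
roots of the eigenvalues of `Xᴴ X`, counted with multiplicity. -/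
def traceNorm (X : Matrix A A ℂ) : ℝ :=
  ∑ i, Real.sqrt ((Matrix.isHermitian_conjTranspose_mul_self X).eigenvalues i)

/-- Partial trace over the second tensor factor. -/
def trB (M : Matrix (A × B) (A × B) ℂ) : Matrix A A ℂ :=
  Matrix.of fun a a' => ∑ b, M (a, b) (a', b)

/-- The map `id_R ⊗ Φ`: `Φ` is applied to each block of a matrix on `R ⊗ A`. -/
def idTensor (R : Type*) (Φ : Matrix A A ℂ →ₗ[ℂ] Matrix B B ℂ) :
    Matrix (R × A) (R × A) ℂ →ₗ[ℂ] Matrix (R × B) (R × B) ℂ where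
  toFun X := Matrix.of fun p q => Φ (Matrix.of fun a a' => X (p.1, a) (q.1, a')) p.2 q.2
  map_add' X Y := by
    ext p q
    exact congrFun (congrFun (Φ.map_add (Matrix.of fun a a' => X (p.1, a) (q.1, a'))
      (Matrix.of fun a a' => Y (p.1, a) (q.1, a'))) p.2) q.2
  map_smul' c X := by
    ext p q
    exact congrFun (congrFun (Φ.map_smul c (Matrix.of fun a a' => X (p.1, a) (q.1, a'))) p.2) q.2

/-- `id_R ⊗ Φ` has its defining action on product operators (which span). -/
theorem idTensor_kronecker {A B R : Type*} (Φ : Matrix A A ℂ →ₗ[ℂ] Matrix B B ℂ) (X : Matrix R R ℂ)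
    (Y : Matrix A A ℂ) :
    idTensor R Φ (Matrix.kroneckerMap (· * ·) X Y) = Matrix.kroneckerMap (· * ·) X (Φ Y) := by
  ext p q
  exact congrFun (congrFun (Φ.map_smul (X p.1 q.1) Y) p.2) q.2

/-- Hermiticity-preserving maps. -/
def IsHermPres (Φ : Matrix A A ℂ →ₗ[ℂ] Matrix B B ℂ) : Prop :=
  ∀ X : Matrix A A ℂ, X.IsHermitian → (Φ X).IsHermitian

/-- Completely positive maps: `id_A ⊗ Φ` is positive. -/
def IsCP (Φ : Matrix A A ℂ →ₗ[ℂ] Matrix B B ℂ) : Prop :=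
  ∀ X : Matrix (A × A) (A × A) ℂ, X.PosSemidef → (idTensor A Φ X).PosSemidef

/-- Trace-non-increasing maps: `Tr Φ(X) ≤ Tr X` for every `X ≥ 0`. -/
def IsTNI (Φ : Matrix A A ℂ →ₗ[ℂ] Matrix B B ℂ) : Prop :=
  ∀ X : Matrix A A ℂ, X.PosSemidef → (Φ X).trace.re ≤ X.trace.re

/-- Completely positive and trace-non-increasing maps. -/
def IsCPTNI (Φ : Matrix A A ℂ →ₗ[ℂ] Matrix B B ℂ) : Prop := IsCP Φ ∧ IsTNI Φ

/-- The unnormalised maximally entangled vector `∑ i, |i i⟩`. -/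
def omegaVec (A : Type*) [DecidableEq A] : A × A → ℂ := fun p => if p.1 = p.2 then 1 else 0

/-- The Choi operator `J_Φ = (id_A ⊗ Φ)(|Ω⟩⟨Ω|)`. -/
def choi (Φ : Matrix A A ℂ →ₗ[ℂ] Matrix B B ℂ) : Matrix (A × B) (A × B) ℂ :=
  idTensor A Φ (Matrix.vecMulVec (omegaVec A) (star (omegaVec A)))

/-- The values `‖(id_A ⊗ Φ)(ρ)‖₁` over the states `ρ` of `A ⊗ A`. -/
def diamondSet (Φ : Matrix A A ℂ →ₗ[ℂ] Matrix B B ℂ) : Set ℝ :=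
  {t | ∃ ρ : Matrix (A × A) (A × A) ℂ, IsDensity ρ ∧ t = traceNorm (idTensor A Φ ρ)}

/-- The diamond norm (completely bounded trace norm). -/
def diamondNorm (Φ : Matrix A A ℂ →ₗ[ℂ] Matrix B B ℂ) : ℝ := sSup (diamondSet Φ)

/-- The values `λ₊ + λ₋` over the decompositions `Φ = λ₊ Λ₊ - λ₋ Λ₋` with `λ± ≥ 0` and
`Λ±` completely positive and trace non-increasing. -/
def baseSet (Φ : Matrix A A ℂ →ₗ[ℂ] Matrix B B ℂ) : Set ℝ :=
  {t | ∃ (l m : ℝ) (L M : Matrix A A ℂ →ₗ[ℂ] Matrix B B ℂ), 0 ≤ l ∧ 0 ≤ m ∧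
    IsCPTNI L ∧ IsCPTNI M ∧ Φ = (l : ℂ) • L - (m : ℂ) • M ∧ t = l + m}

/-- The base norm with respect to the completely positive trace-non-increasing maps. -/
def baseNorm (Φ : Matrix A A ℂ →ₗ[ℂ] Matrix B B ℂ) : ℝ := sInf (baseSet Φ)

/-- The feasible `λ` of `R'`: `J_Φ ≤ (1 + λ) J_Λ` with weight `1 + λ ≥ 0` and
`Λ` completely positive and trace non-increasing. -/
def robSet' (Φ : Matrix A A ℂ →ₗ[ℂ] Matrix B B ℂ) : Set ℝ :=
  {l | 0 ≤ 1 + l ∧ ∃ L : Matrix A A ℂ →ₗ[ℂ] Matrix B B ℂ, IsCPTNI L ∧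
    (((1 + l : ℝ) : ℂ) • choi L - choi Φ).PosSemidef}

/-- The robustness `R'`. -/
def rob' (Φ : Matrix A A ℂ →ₗ[ℂ] Matrix B B ℂ) : ℝ := sInf (robSet' Φ)

/-- The feasible `λ` of `R''`: `Φ + λ Λ` is completely positive, with weight `λ ≥ 0` and
`Λ` completely positive and trace non-increasing. -/
def robSet'' (Φ : Matrix A A ℂ →ₗ[ℂ] Matrix B B ℂ) : Set ℝ :=
  {l | 0 ≤ l ∧ ∃ L : Matrix A A ℂ →ₗ[ℂ] Matrix B B ℂ, IsCPTNI L ∧ IsCP (Φ + (l : ℂ) • L)}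

/-- The robustness `R''`. -/
def rob'' (Φ : Matrix A A ℂ →ₗ[ℂ] Matrix B B ℂ) : ℝ := sInf (robSet'' Φ)

/-- The smallest eigenvalue of a Hermitian matrix. -/
def lamMin (M : Matrix A A ℂ) : ℝ := sInf (spectrum ℝ M)

/-- The largest eigenvalue of a Hermitian matrix. -/
def lamMax (M : Matrix A A ℂ) : ℝ := sSup (spectrum ℝ M)

end QuantumMap

end

noncomputable section

open scoped ComplexOrder Kronecker
open Matrix

namespace QuantumMap

/-! ### Trace norm and positivity of Hermitian matrices. -/

section Hermitian

variable {n : Type*} [Fintype n]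

/-! Everything reduces to semidefinite duality for the diamond norm: `‖Φ‖_⋄` is the infimum of those
`t` for which `J_Φ = P - N` with `P, N ≥ 0` and `Tr_B (P + N) ≤ t • 1`.

Weak duality (`traceNorm_idTensor_le`, `diamondNorm_le`) holds because `P` and `N` are Choi
operators of CP maps and `‖X - Y‖₁ ≤ Tr (X + Y)` for `X, Y ≥ 0`. Strong duality
(`exists_decomposition`) is a separation argument: a functional separating `e • 1`, with `e` above
the diamond norm, from the attainable upper bounds on `Tr_B (P + N)` is a positive weight `σ`. The
Jordan decomposition of `id ⊗ Φ` at a purification of a perturbed `σ` then contradicts the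
separation.

Dividing `P` and `N` by `t` gives `Φ = t L - t M` with `L, M` CPTNI for every `t` above the diamond
norm, hence the upper bounds on the three minima. Conversely, a feasible point of each minimum
yields a pair `P, N`, and weak duality gives the lower bounds. The minima are attained because the
Choi operators of CPTNI maps form a compact set; the maximum, by compactness of the set of states.
-/

theorem re_trace_nonneg {P : Matrix n n ℂ} (hP : P.PosSemidef) : 0 ≤ P.trace.re :=
  (Complex.le_def.1 hP.trace_nonneg).1

theorem norm_apply_sq_le (M : Matrix n n ℂ) (i j : n) : ‖M i j‖ ^ 2 ≤ (Mᴴ * M).trace.re := by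
  have : (Mᴴ * M).trace.re = ∑ k, ∑ l, ‖M l k‖ ^ 2 := by
    simp only [Matrix.trace, diag_apply, Matrix.mul_apply, conjTranspose_apply, Complex.re_sum]
    refine Finset.sum_congr rfl fun k _ => Finset.sum_congr rfl fun l _ => ?_
    rw [Complex.star_def, ← Complex.normSq_eq_conj_mul_self, Complex.normSq_eq_norm_sq,
      Complex.ofReal_re]
  rw [this]
  refine le_trans ?_ (Finset.single_le_sum (f := fun k => ∑ l, ‖M l k‖ ^ 2)
    (fun k _ => Finset.sum_nonneg fun l _ => sq_nonneg _) (Finset.mem_univ j))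
  exact Finset.single_le_sum (f := fun l => ‖M l j‖ ^ 2) (fun l _ => sq_nonneg _)
    (Finset.mem_univ i)

theorem isClosed_posSemidef : IsClosed {M : Matrix n n ℂ | M.PosSemidef} := by
  have : {M : Matrix n n ℂ | M.PosSemidef} =
      {M | Mᴴ = M} ∩ ⋂ x : n → ℂ, {M | 0 ≤ star x ⬝ᵥ (M *ᵥ x)} := by
    ext M
    simp only [Set.mem_ofPred_eq, Set.mem_inter_iff, Set.mem_iInter]
    exact posSemidef_iff_dotProduct_mulVec
  rw [this]
  refine (isClosed_eq (by fun_prop) continuous_id).inter (isClosed_iInter fun x => ?_)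
  exact isClosed_le continuous_const (by fun_prop)

variable [DecidableEq n]

theorem exists_unitary_diagonalization {M : Matrix n n ℂ} (hM : M.IsHermitian) :
    ∃ (U : Matrix n n ℂ) (d : n → ℝ), Uᴴ * U = 1 ∧ U * Uᴴ = 1 ∧
      M = U * diagonal (fun i => (d i : ℂ)) * Uᴴ := by
  refine ⟨hM.eigenvectorUnitary, hM.eigenvalues, ?_, ?_, ?_⟩
  · exact Unitary.coe_star_mul_self hM.eigenvectorUnitary
  · exact Unitary.coe_mul_star_self hM.eigenvectorUnitary
  · have h := hM.spectral_theorem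
    rw [Unitary.conjStarAlgAut_apply] at h
    exact h

theorem trace_conj_unitary {U M : Matrix n n ℂ} (hU : Uᴴ * U = 1) :
    (U * M * Uᴴ).trace = M.trace := by
  rw [Matrix.trace_mul_comm, ← Matrix.mul_assoc, hU, Matrix.one_mul]

theorem traceNorm_conj_diagonal {U : Matrix n n ℂ} (d : n → ℝ) (hU : Uᴴ * U = 1) :
    traceNorm (U * diagonal (fun i => (d i : ℂ)) * Uᴴ) = ∑ i, |d i| := by
  set X := U * diagonal (fun i => (d i : ℂ)) * Uᴴ with hX
  have hsq : Xᴴ * X = U * diagonal (fun i => ((d i ^ 2 : ℝ) : ℂ)) * Uᴴ := by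
    have h1 : Xᴴ = X := by
      simp only [hX, conjTranspose_mul, conjTranspose_conjTranspose, diagonal_conjTranspose,
        Matrix.mul_assoc]
      congr 3
      ext i; simp
    rw [h1, hX]
    calc U * diagonal (fun i => (d i : ℂ)) * Uᴴ * (U * diagonal (fun i => (d i : ℂ)) * Uᴴ)
        = U * (diagonal (fun i => (d i : ℂ)) * (Uᴴ * U) * diagonal (fun i => (d i : ℂ))) * Uᴴ := by
          simp only [Matrix.mul_assoc]
      _ = _ := by
          rw [hU, Matrix.mul_one, diagonal_mul_diagonal]
          congr 3
          ext i; push_cast; ring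
  have hchar : (Xᴴ * X).charpoly = ∏ i, (Polynomial.X - Polynomial.C ((d i ^ 2 : ℝ) : ℂ)) := by
    rw [hsq, charpoly_mul_comm, ← Matrix.mul_assoc, hU, Matrix.one_mul, charpoly_diagonal]
  have hroots := (Matrix.isHermitian_conjTranspose_mul_self X).roots_charpoly_eq_eigenvalues
  rw [hchar, Polynomial.roots_prod _ _
    (Finset.prod_ne_zero_iff.2 fun i _ => Polynomial.X_sub_C_ne_zero _)] at hroots
  simp only [Polynomial.roots_X_sub_C, Multiset.bind_singleton] at hroots
  -- The eigenvalues are known only up to reordering, so the two root multisets are compared through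
  -- a symmetric function, the sum of square roots.
  have h2 := congrArg (fun s => (s.map (fun z : ℂ => Real.sqrt z.re)).sum) hroots
  simp only [Multiset.map_map, Function.comp_def] at h2
  unfold traceNorm
  refine Eq.trans ?_ (h2.symm.trans ?_)
  · rfl
  · simp only [Complex.ofReal_re, Real.sqrt_sq_eq_abs]
    rfl

/-- Jordan decomposition: a Hermitian matrix splits into a positive and a negative part whose
traces add up to the trace norm. -/
theorem exists_jordan_decomposition {X : Matrix n n ℂ} (hX : X.IsHermitian) :
    ∃ P N : Matrix n n ℂ, P.PosSemidef ∧ N.PosSemidef ∧ X = P - N ∧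
      traceNorm X = (P + N).trace.re := by
  obtain ⟨U, d, hU, -, rfl⟩ := exists_unitary_diagonalization hX
  refine ⟨U * diagonal (fun i => ((max (d i) 0 : ℝ) : ℂ)) * Uᴴ,
    U * diagonal (fun i => ((max (-d i) 0 : ℝ) : ℂ)) * Uᴴ, ?_, ?_, ?_, ?_⟩
  · refine PosSemidef.mul_mul_conjTranspose_same (PosSemidef.diagonal fun i => ?_) U
    simp
  · refine PosSemidef.mul_mul_conjTranspose_same (PosSemidef.diagonal fun i => ?_) U
    simp
  · rw [← Matrix.sub_mul, ← Matrix.mul_sub, diagonal_sub]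
    congr 3
    ext i
    rw [← Complex.ofReal_sub]
    congr 1
    rcases le_total 0 (d i) with h | h <;> simp [h]
  · rw [traceNorm_conj_diagonal d hU, trace_add, trace_conj_unitary hU, trace_conj_unitary hU,
      trace_diagonal, trace_diagonal, ← Finset.sum_add_distrib, Complex.re_sum]
    refine Finset.sum_congr rfl fun i _ => ?_
    rw [← Complex.ofReal_add, Complex.ofReal_re]
    rcases le_total 0 (d i) with h | h <;> simp [h, abs_of_nonneg, abs_of_nonpos]

/-- In an eigenbasis of `P - N` each eigenvalue is a difference of nonnegative diagonal entries of
`P` and `N`, so its modulus is at most their sum. Together with the Jordan decomposition this makes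
the trace norm a minimum of `Tr (P + N)`, from which the triangle inequality follows. -/
theorem traceNorm_sub_le {P N : Matrix n n ℂ} (hP : P.PosSemidef) (hN : N.PosSemidef) :
    traceNorm (P - N) ≤ (P + N).trace.re := by
  obtain ⟨U, d, hU, hU', hd⟩ := exists_unitary_diagonalization (hP.isHermitian.sub hN.isHermitian)
  rw [hd, traceNorm_conj_diagonal d hU]
  have htr : (P + N).trace = (Uᴴ * P * U).trace + (Uᴴ * N * U).trace := by
    rw [Matrix.trace_mul_comm, ← Matrix.mul_assoc, hU', Matrix.one_mul, Matrix.trace_mul_comm _ U,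
      ← Matrix.mul_assoc, hU', Matrix.one_mul, trace_add]
  have hD : diagonal (fun i => (d i : ℂ)) = Uᴴ * P * U - Uᴴ * N * U := by
    rw [← Matrix.sub_mul, ← Matrix.mul_sub, hd]
    simp only [← Matrix.mul_assoc, hU, Matrix.one_mul]
    rw [Matrix.mul_assoc, hU, Matrix.mul_one]
  rw [htr, Matrix.trace, Matrix.trace, ← Finset.sum_add_distrib, Complex.re_sum]
  refine Finset.sum_le_sum fun i _ => ?_
  have h1 := (hP.conjTranspose_mul_mul_same U).diag_nonneg (i := i)
  have h2 := (hN.conjTranspose_mul_mul_same U).diag_nonneg (i := i)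
  have h3 := congrArg Complex.re (congrFun (congrFun hD i) i)
  simp only [diagonal_apply_eq, Complex.ofReal_re, Matrix.sub_apply, Complex.sub_re] at h3
  rw [Complex.le_def] at h1 h2
  simp only [Complex.zero_re, diag_apply, Complex.add_re] at h1 h2 ⊢
  rw [h3, abs_le]
  constructor <;> linarith [h1.1, h2.1]

theorem traceNorm_nonneg (X : Matrix n n ℂ) : 0 ≤ traceNorm X :=
  Finset.sum_nonneg fun _ _ => Real.sqrt_nonneg _

theorem traceNorm_add_le {X Y : Matrix n n ℂ} (hX : X.IsHermitian) (hY : Y.IsHermitian) :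
    traceNorm (X + Y) ≤ traceNorm X + traceNorm Y := by
  obtain ⟨P, N, hP, hN, hd, ht⟩ := exists_jordan_decomposition hX
  obtain ⟨P', N', hP', hN', hd', ht'⟩ := exists_jordan_decomposition hY
  have h := traceNorm_sub_le (hP.add hP') (hN.add hN')
  have e : P + P' - (N + N') = X + Y := by rw [hd, hd']; abel
  rw [e] at h
  refine h.trans (le_of_eq ?_)
  rw [ht, ht']
  simp only [trace_add, Complex.add_re]
  ring

theorem traceNorm_smul_le {X : Matrix n n ℂ} (hX : X.IsHermitian) {c : ℝ} (hc : 0 ≤ c) :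
    traceNorm ((c : ℂ) • X) ≤ c * traceNorm X := by
  obtain ⟨P, N, hP, hN, rfl, ht⟩ := exists_jordan_decomposition hX
  have hc' : (0 : ℂ) ≤ c := by exact_mod_cast hc
  have h := traceNorm_sub_le (hP.smul hc') (hN.smul hc')
  rw [← smul_sub, ← smul_add, trace_smul, smul_eq_mul, Complex.re_ofReal_mul, ← ht] at h
  exact h

/-- Cauchy–Schwarz over the singular values. The right side is visibly continuous in the entries,
which later gives continuity of the trace norm. -/
theorem traceNorm_le_sqrt (X : Matrix n n ℂ) :
    traceNorm X ≤ Real.sqrt (Fintype.card n * (Xᴴ * X).trace.re) := by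
  have hH := Matrix.isHermitian_conjTranspose_mul_self X
  have hpos : ∀ i, 0 ≤ hH.eigenvalues i :=
    fun i => (posSemidef_conjTranspose_mul_self X).eigenvalues_nonneg i
  rw [hH.trace_eq_sum_eigenvalues]
  refine Real.le_sqrt_of_sq_le ?_
  have h := sq_sum_le_card_mul_sum_sq (s := Finset.univ)
    (f := fun i => Real.sqrt (hH.eigenvalues i))
  simp only [Real.sq_sqrt (hpos _)] at h
  rw [Complex.re_sum]
  simpa [traceNorm] using h

theorem exists_eq_conjTranspose_mul_self {P : Matrix n n ℂ} (hP : P.PosSemidef) :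
    ∃ K : Matrix n n ℂ, P = Kᴴ * K := by
  open scoped MatrixOrder in
  exact CStarAlgebra.nonneg_iff_eq_star_mul_self.mp hP.nonneg

theorem trace_mul_re_nonneg {P Q : Matrix n n ℂ} (hP : P.PosSemidef) (hQ : Q.PosSemidef) :
    0 ≤ (P * Q).trace.re := by
  obtain ⟨K, rfl⟩ := exists_eq_conjTranspose_mul_self hQ
  rw [← Matrix.mul_assoc, Matrix.trace_mul_comm, ← Matrix.mul_assoc]
  exact re_trace_nonneg (hP.mul_mul_conjTranspose_same K)

theorem re_trace_hermitian_mul_self {U : Matrix n n ℂ} (d : n → ℝ) (hU : Uᴴ * U = 1)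
    {M : Matrix n n ℂ} (hM : M = U * diagonal (fun i => (d i : ℂ)) * Uᴴ) :
    (Mᴴ * M).trace.re = ∑ i, d i ^ 2 := by
  subst hM
  simp only [conjTranspose_mul, conjTranspose_conjTranspose, diagonal_conjTranspose]
  calc _ = (U * (diagonal (star fun i => (d i : ℂ)) * (Uᴴ * U) *
        diagonal (fun i => (d i : ℂ))) * Uᴴ).trace.re := by simp only [Matrix.mul_assoc]
    _ = _ := by
      rw [trace_conj_unitary hU, hU, Matrix.mul_one, diagonal_mul_diagonal, trace_diagonal,
        Complex.re_sum]
      refine Finset.sum_congr rfl fun i _ => ?_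
      simp [sq]

/-- Each eigenvalue is bounded by the Hilbert–Schmidt norm. This turns closeness in norm into an
operator inequality. -/
theorem smul_one_sub_posSemidef_of_trace {M : Matrix n n ℂ} (hM : M.IsHermitian) {η : ℝ}
    (hη : 0 ≤ η) (h : (Mᴴ * M).trace.re ≤ η ^ 2) : ((η : ℂ) • 1 - M).PosSemidef := by
  obtain ⟨U, d, hU, hU', hd⟩ := exists_unitary_diagonalization hM
  rw [re_trace_hermitian_mul_self d hU hd] at h
  have e : (η : ℂ) • 1 - M = U * diagonal (fun i => ((η - d i : ℝ) : ℂ)) * Uᴴ := by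
    have : diagonal (fun i => ((η - d i : ℝ) : ℂ)) =
        (η : ℂ) • (1 : Matrix n n ℂ) - diagonal (fun i => (d i : ℂ)) := by
      ext i j
      by_cases hij : i = j <;> simp [hij, diagonal]
    rw [this, Matrix.mul_sub, Matrix.sub_mul, ← hd, Matrix.mul_smul, Matrix.mul_one,
      Matrix.smul_mul, hU']
  rw [e]
  refine PosSemidef.mul_mul_conjTranspose_same (PosSemidef.diagonal fun i => ?_) U
  have h1 : d i ^ 2 ≤ ∑ j, d j ^ 2 :=
    Finset.single_le_sum (f := fun j => d j ^ 2) (fun j _ => sq_nonneg _) (Finset.mem_univ i)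
  have := abs_le_of_sq_le_sq (h1.trans h) hη
  simp only [Pi.zero_apply]
  exact_mod_cast sub_nonneg.2 (le_of_abs_le this)

theorem re_trace_conjTranspose_mul_self_le {P : Matrix n n ℂ} (hP : P.PosSemidef) :
    (Pᴴ * P).trace.re ≤ P.trace.re ^ 2 := by
  have hd := exists_unitary_diagonalization hP.isHermitian
  obtain ⟨U, d, hU, hU', hd⟩ := hd
  have hpos : ∀ i, 0 ≤ d i := by
    intro i
    have h1 := (hP.conjTranspose_mul_mul_same U).diag_nonneg (i := i)
    have : Uᴴ * P * U = diagonal (fun i => (d i : ℂ)) := by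
      rw [hd]
      simp only [← Matrix.mul_assoc, hU, Matrix.one_mul]
      rw [Matrix.mul_assoc, hU, Matrix.mul_one]
    rw [this, diagonal_apply_eq] at h1
    exact_mod_cast h1
  rw [re_trace_hermitian_mul_self d hU hd, hd, trace_conj_unitary hU, trace_diagonal,
    Complex.re_sum]
  simpa using Finset.sum_sq_le_sq_sum_of_nonneg (s := Finset.univ) (f := d) fun i _ => hpos i

theorem norm_apply_le_re_trace {P : Matrix n n ℂ} (hP : P.PosSemidef) (i j : n) :
    ‖P i j‖ ≤ P.trace.re :=
  abs_le_of_sq_le_sq' ((norm_apply_sq_le P i j).trans (re_trace_conjTranspose_mul_self_le hP))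
    (re_trace_nonneg hP) |>.2

theorem isCompact_of_posSemidef_of_trace_le {S : Set (Matrix n n ℂ)} (hS : IsClosed S)
    (hpos : ∀ M ∈ S, M.PosSemidef) {c : ℝ} (hc : ∀ M ∈ S, M.trace.re ≤ c) : IsCompact S := by
  refine IsCompact.of_isClosed_subset (s := Set.univ.pi fun _ => Set.univ.pi fun _ =>
    Metric.closedBall (0 : ℂ) c) ?_ hS ?_
  · exact isCompact_univ_pi fun _ => isCompact_univ_pi fun _ => isCompact_closedBall _ _
  · intro M hM i _ j _
    rw [mem_closedBall_zero_iff]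
    exact (norm_apply_le_re_trace (hpos M hM) i j).trans (hc M hM)

end Hermitian

/-! ### Choi operators and complete positivity. -/

section Choi

variable {A B : Type*}

/-- `X + Xᴴ` and `i (X - Xᴴ)` are Hermitian and determine `X` linearly. -/
theorem IsHermPres.map_conjTranspose {Φ : Matrix A A ℂ →ₗ[ℂ] Matrix B B ℂ} (hΦ : IsHermPres Φ)
    (X : Matrix A A ℂ) : Φ Xᴴ = (Φ X)ᴴ := by
  have h1 := hΦ (X + Xᴴ) (isHermitian_add_transpose_self X)
  have h2 := hΦ (Complex.I • (X - Xᴴ)) (by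
    simp only [IsHermitian, conjTranspose_smul, conjTranspose_sub, conjTranspose_conjTranspose,
      Complex.star_def, Complex.conj_I]
    rw [neg_smul, ← smul_neg, neg_sub])
  simp only [IsHermitian, map_add, map_smul, map_sub, conjTranspose_add, conjTranspose_smul,
    conjTranspose_sub, Complex.star_def, Complex.conj_I] at h1 h2
  ext b b'
  have e1 := congrFun (congrFun h1 b) b'
  have e2 := congrFun (congrFun h2 b) b'
  simp only [Matrix.add_apply, Matrix.smul_apply, Matrix.sub_apply, smul_eq_mul] at e1 e2
  have e3 : (Φ X)ᴴ b b' - (Φ Xᴴ)ᴴ b b' = -(Φ X b b' - Φ Xᴴ b b') := by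
    apply mul_left_cancel₀ Complex.I_ne_zero
    linear_combination -e2
  linear_combination -(1 / 2 : ℂ) * (e1 + e3)

theorem IsHermPres.isHermitian_idTensor {R : Type*} {Φ : Matrix A A ℂ →ₗ[ℂ] Matrix B B ℂ}
    (hΦ : IsHermPres Φ) {X : Matrix (R × A) (R × A) ℂ} (hX : X.IsHermitian) :
    (idTensor R Φ X).IsHermitian := by
  ext p q
  rw [conjTranspose_apply]
  have h := hΦ.map_conjTranspose (Matrix.of fun a a' => X (q.1, a) (p.1, a'))
  have e : (Matrix.of fun a a' => X (q.1, a) (p.1, a'))ᴴ =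
      Matrix.of fun a a' => X (p.1, a) (q.1, a') := by
    ext a a'
    simp only [conjTranspose_apply, of_apply]
    exact hX.apply _ _
  rw [e] at h
  exact (congrFun (congrFun h p.2) q.2).symm

variable [DecidableEq A]

theorem IsHermPres.isHermitian_choi [Fintype A] {Φ : Matrix A A ℂ →ₗ[ℂ] Matrix B B ℂ}
    (hΦ : IsHermPres Φ) : (choi Φ).IsHermitian :=
  hΦ.isHermitian_idTensor (posSemidef_vecMulVec_self_star _).isHermitian

theorem choi_apply (Φ : Matrix A A ℂ →ₗ[ℂ] Matrix B B ℂ) (p q : A × B) :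
    choi Φ p q = Φ (Matrix.single p.1 q.1 1) p.2 q.2 := by
  have : (Matrix.of fun a a' => vecMulVec (omegaVec A) (star (omegaVec A)) (p.1, a) (q.1, a')) =
      Matrix.single p.1 q.1 (1 : ℂ) := by
    ext a a'
    simp only [of_apply, vecMulVec_apply, omegaVec, Pi.star_apply, Matrix.single]
    split_ifs <;> simp_all
  rw [← this]
  rfl

theorem choi_add (Φ Ψ : Matrix A A ℂ →ₗ[ℂ] Matrix B B ℂ) : choi (Φ + Ψ) = choi Φ + choi Ψ := rfl

theorem choi_sub (Φ Ψ : Matrix A A ℂ →ₗ[ℂ] Matrix B B ℂ) : choi (Φ - Ψ) = choi Φ - choi Ψ := rfl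

theorem choi_smul (c : ℂ) (Φ : Matrix A A ℂ →ₗ[ℂ] Matrix B B ℂ) : choi (c • Φ) = c • choi Φ := rfl

variable [Fintype A]

theorem apply_eq_sum_choi (Φ : Matrix A A ℂ →ₗ[ℂ] Matrix B B ℂ) (X : Matrix A A ℂ) (b b' : B) :
    Φ X b b' = ∑ a, ∑ a', X a a' * choi Φ (a, b) (a', b') := by
  conv_lhs => rw [matrix_eq_sum_single X]
  simp only [map_sum, Matrix.sum_apply, choi_apply]
  refine Finset.sum_congr rfl fun a _ => Finset.sum_congr rfl fun a' _ => ?_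
  have : Matrix.single a a' (X a a') = X a a' • Matrix.single a a' (1 : ℂ) := by simp
  rw [this, map_smul, Matrix.smul_apply, smul_eq_mul]

/-- The linear map with a given Choi operator. -/
def ofChoi (C : Matrix (A × B) (A × B) ℂ) : Matrix A A ℂ →ₗ[ℂ] Matrix B B ℂ where
  toFun X := Matrix.of fun b b' => ∑ a, ∑ a', X a a' * C (a, b) (a', b')
  map_add' X Y := by
    ext b b'
    simp [add_mul, Finset.sum_add_distrib]
  map_smul' c X := by
    ext b b'
    simp [Finset.mul_sum, mul_assoc]

theorem choi_ofChoi (C : Matrix (A × B) (A × B) ℂ) : choi (ofChoi C) = C := by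
  ext p q
  rw [choi_apply]
  simp only [ofChoi, LinearMap.coe_mk, AddHom.coe_mk, of_apply]
  rw [Finset.sum_eq_single p.1, Finset.sum_eq_single q.1] <;> simp +contextual [Matrix.single, eq_comm]

theorem ofChoi_choi (Φ : Matrix A A ℂ →ₗ[ℂ] Matrix B B ℂ) : ofChoi (choi Φ) = Φ := by
  ext1 X
  ext b b'
  exact (apply_eq_sum_choi Φ X b b').symm

theorem choi_injective :
    Function.Injective (choi : (Matrix A A ℂ →ₗ[ℂ] Matrix B B ℂ) → _) :=
  Function.LeftInverse.injective ofChoi_choi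

theorem isCP_iff [Fintype B] [DecidableEq B] {Φ : Matrix A A ℂ →ₗ[ℂ] Matrix B B ℂ} :
    IsCP Φ ↔ (choi Φ).PosSemidef := by
  refine ⟨fun h => h _ (posSemidef_vecMulVec_self_star _), fun h X hX => ?_⟩
  -- `W` is `1 ⊗ |Ω⟩ ⊗ 1`: it contracts the input factor of `X` with the input factor of the Choi
  -- operator.
  let W : Matrix ((A × A) × (A × B)) (A × B) ℂ :=
    Matrix.of fun k p => if k.1.1 = p.1 ∧ k.1.2 = k.2.1 ∧ k.2.2 = p.2 then 1 else 0
  have key : idTensor A Φ X = Wᴴ * (X ⊗ₖ choi Φ) * W := by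
    ext p q
    have h1 : idTensor A Φ X p q = ∑ a, ∑ a', X (p.1, a) (q.1, a') * choi Φ (a, p.2) (a', q.2) :=
      apply_eq_sum_choi Φ _ _ _
    rw [h1]
    simp only [Matrix.mul_apply, conjTranspose_apply, W, of_apply, kroneckerMap_apply,
      Fintype.sum_prod_type, ite_and, apply_ite star, star_one, star_zero, ite_mul, one_mul,
      zero_mul, mul_ite, mul_one, mul_zero, Finset.sum_ite_irrel, Finset.sum_const_zero,
      Finset.sum_ite_eq, Finset.sum_ite_eq', Finset.mem_univ, if_true]
    rw [Finset.sum_comm]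
  rw [key]
  exact (hX.kronecker h).conjTranspose_mul_mul_same W

end Choi

/-! ### Partial traces and operators `T ⊗ 1`. -/

section PartialTrace

variable {A B : Type*} [Fintype B]

theorem trB_add (M N : Matrix (A × B) (A × B) ℂ) : trB (M + N) = trB M + trB N := by
  ext a a'
  simp [trB, Finset.sum_add_distrib]

theorem trB_sub (M N : Matrix (A × B) (A × B) ℂ) : trB (M - N) = trB M - trB N := by
  ext a a'
  simp [trB, Finset.sum_sub_distrib]

theorem trB_smul (c : ℂ) (M : Matrix (A × B) (A × B) ℂ) : trB (c • M) = c • trB M := by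
  ext a a'
  simp [trB, Finset.mul_sum]

theorem trB_isHermitian {M : Matrix (A × B) (A × B) ℂ} (hM : M.IsHermitian) :
    (trB M).IsHermitian := by
  ext a a'
  simp only [trB, conjTranspose_apply, of_apply, star_sum]
  exact Finset.sum_congr rfl fun b _ => hM.apply _ _

theorem trB_posSemidef {M : Matrix (A × B) (A × B) ℂ} (hM : M.PosSemidef) :
    (trB M).PosSemidef := by
  have : trB M = ∑ b, M.submatrix (fun a => (a, b)) (fun a => (a, b)) := by
    ext a a'
    simp [trB, Matrix.sum_apply]
  rw [this]
  exact posSemidef_sum _ fun b _ => hM.submatrix _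

theorem continuous_trB : Continuous (trB : Matrix (A × B) (A × B) ℂ → Matrix A A ℂ) := by
  unfold trB
  exact continuous_matrix fun a a' => by
    simp only [of_apply]
    fun_prop

variable [Fintype A]

theorem trace_trB (M : Matrix (A × B) (A × B) ℂ) : (trB M).trace = M.trace := by
  simp [trB, Matrix.trace, Fintype.sum_prod_type]

theorem trace_kronecker_one_mul [DecidableEq B] (S : Matrix A A ℂ)
    (M : Matrix (A × B) (A × B) ℂ) :
    ((S ⊗ₖ (1 : Matrix B B ℂ)) * M).trace = (S * trB M).trace := by
  simp only [Matrix.trace, diag_apply, Matrix.mul_apply, Fintype.sum_prod_type, kroneckerMap_apply,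
    Matrix.one_apply, trB, of_apply, mul_ite, mul_one, mul_zero, ite_mul, zero_mul,
    Finset.sum_ite_eq, Finset.mem_univ, if_true, Finset.mul_sum]
  exact Finset.sum_congr rfl fun a _ => Finset.sum_comm

theorem posSemidef_of_re_nonneg {M : Matrix A A ℂ} (hM : M.IsHermitian)
    (h : ∀ v : A → ℂ, 0 ≤ (star v ⬝ᵥ (M *ᵥ v)).re) : M.PosSemidef := by
  refine PosSemidef.of_dotProduct_mulVec_nonneg hM fun v => ?_
  rw [Complex.le_def]
  exact ⟨h v, (hM.im_star_dotProduct_mulVec_self v).symm⟩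

theorem trace_vecMulVec_mul (M : Matrix A A ℂ) (v w : A → ℂ) :
    (M * vecMulVec v w).trace = w ⬝ᵥ (M *ᵥ v) := by
  rw [Matrix.mul_vecMulVec, trace_vecMulVec, dotProduct_comm]

variable [DecidableEq B]

theorem kronecker_one_conj_apply (T : Matrix A A ℂ) (Z : Matrix (A × B) (A × B) ℂ) (p q : A × B) :
    ((T ⊗ₖ (1 : Matrix B B ℂ)) * Z * (T ⊗ₖ (1 : Matrix B B ℂ))ᴴ) p q =
      ∑ s', ∑ s, (T p.1 s * star (T q.1 s')) * Z (s, p.2) (s', q.2) := by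
  simp only [Matrix.mul_apply, conjTranspose_apply, Fintype.sum_prod_type, kroneckerMap_apply,
    Matrix.one_apply, mul_ite, mul_one, mul_zero, ite_mul, zero_mul, apply_ite star, star_zero,
    Finset.sum_ite_eq, Finset.mem_univ, if_true, Finset.sum_mul]
  exact Finset.sum_congr rfl fun _ _ => Finset.sum_congr rfl fun _ _ => by ring

theorem kronecker_one_conjTranspose_mul_self (T : Matrix A A ℂ) :
    (T ⊗ₖ (1 : Matrix B B ℂ))ᴴ * (T ⊗ₖ (1 : Matrix B B ℂ)) = (Tᴴ * T) ⊗ₖ 1 := by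
  rw [conjTranspose_kronecker, ← mul_kronecker_mul, conjTranspose_one, Matrix.one_mul]

end PartialTrace

/-! ### Trace bounds and duality for the diamond norm. -/

section Duality

variable {A B : Type*} [Fintype A] [DecidableEq A] [Fintype B]

theorem trace_apply_eq (Φ : Matrix A A ℂ →ₗ[ℂ] Matrix B B ℂ) (X : Matrix A A ℂ) :
    (Φ X).trace = (X * (trB (choi Φ))ᵀ).trace := by
  simp only [Matrix.trace, diag_apply, Matrix.mul_apply, transpose_apply, trB, of_apply,
    apply_eq_sum_choi Φ X, Finset.mul_sum]
  rw [Finset.sum_comm]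
  exact Finset.sum_congr rfl fun a _ => Finset.sum_comm

theorem trace_apply_re_le {Φ : Matrix A A ℂ →ₗ[ℂ] Matrix B B ℂ} {t : ℝ}
    (h : ((t : ℂ) • 1 - trB (choi Φ)).PosSemidef) {X : Matrix A A ℂ} (hX : X.PosSemidef) :
    (Φ X).trace.re ≤ t * X.trace.re := by
  have h1 := trace_mul_re_nonneg hX h.transpose
  rw [transpose_sub, Matrix.mul_sub, trace_sub, ← trace_apply_eq, transpose_smul, transpose_one,
    Matrix.mul_smul, Matrix.mul_one, trace_smul, smul_eq_mul, Complex.sub_re,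
    Complex.re_ofReal_mul] at h1
  linarith

theorem trace_idTensor_re_le {R : Type*} [Fintype R] {Φ : Matrix A A ℂ →ₗ[ℂ] Matrix B B ℂ} {t : ℝ}
    (h : ((t : ℂ) • 1 - trB (choi Φ)).PosSemidef) {X : Matrix (R × A) (R × A) ℂ}
    (hX : X.PosSemidef) : (idTensor R Φ X).trace.re ≤ t * X.trace.re := by
  have h1 : (idTensor R Φ X).trace =
      ∑ r, (Φ (X.submatrix (fun a => (r, a)) (fun a => (r, a)))).trace := by
    simp only [Matrix.trace, Fintype.sum_prod_type]
    rfl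
  have h2 : X.trace = ∑ r, (X.submatrix (fun a => (r, a)) (fun a => (r, a))).trace := by
    simp only [Matrix.trace, Fintype.sum_prod_type]
    rfl
  rw [h1, h2, Complex.re_sum, Complex.re_sum, Finset.mul_sum]
  exact Finset.sum_le_sum fun r _ => trace_apply_re_le h (hX.submatrix _)

theorem isCPTNI_iff [DecidableEq B] {Φ : Matrix A A ℂ →ₗ[ℂ] Matrix B B ℂ} :
    IsCPTNI Φ ↔ (choi Φ).PosSemidef ∧ (1 - trB (choi Φ)).PosSemidef := by
  unfold IsCPTNI
  rw [isCP_iff]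
  refine and_congr_right fun hP => ⟨fun h => ?_, fun h X hX => ?_⟩
  · refine posSemidef_of_re_nonneg (isHermitian_one.sub (trB_isHermitian hP.isHermitian))
      fun v => ?_
    -- The conjugate rank-one operator is tested because `Tr Φ(X)` pairs `X` with the transpose of
    -- `Tr_B J_Φ`.
    have h1 := h _ (posSemidef_vecMulVec_star_self v)
    rw [trace_apply_eq, ← trace_transpose, transpose_mul, transpose_transpose,
      transpose_vecMulVec, trace_vecMulVec_mul, trace_vecMulVec] at h1
    rw [Matrix.sub_mulVec, one_mulVec, dotProduct_sub, Complex.sub_re]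
    linarith
  · have := trace_apply_re_le (t := 1) (by simpa using h) hX
    simpa using this

variable [DecidableEq B]

/-- Weak duality for the diamond norm. -/
theorem traceNorm_idTensor_le {Φ : Matrix A A ℂ →ₗ[ℂ] Matrix B B ℂ}
    {P N : Matrix (A × B) (A × B) ℂ} (hP : P.PosSemidef) (hN : N.PosSemidef)
    (hΦ : choi Φ = P - N) {t : ℝ} (ht : ((t : ℂ) • 1 - trB (P + N)).PosSemidef)
    {X : Matrix (A × A) (A × A) ℂ} (hX : X.PosSemidef) :
    traceNorm (idTensor A Φ X) ≤ t * X.trace.re := by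
  have hΦ' : Φ = ofChoi P - ofChoi N := by
    apply choi_injective
    rw [choi_sub, choi_ofChoi, choi_ofChoi, hΦ]
  have hcP : IsCP (ofChoi P) := isCP_iff.2 (by rwa [choi_ofChoi])
  have hcN : IsCP (ofChoi N) := isCP_iff.2 (by rwa [choi_ofChoi])
  have h := traceNorm_sub_le (hcP X hX) (hcN X hX)
  rw [hΦ']
  refine h.trans (trace_idTensor_re_le (Φ := ofChoi P + ofChoi N) ?_ hX)
  rwa [choi_add, choi_ofChoi, choi_ofChoi]

theorem idTensor_conj_kronecker (Φ : Matrix A A ℂ →ₗ[ℂ] Matrix B B ℂ) (T : Matrix A A ℂ)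
    (Y : Matrix (A × A) (A × A) ℂ) :
    idTensor A Φ ((T ⊗ₖ (1 : Matrix A A ℂ)) * Y * (T ⊗ₖ (1 : Matrix A A ℂ))ᴴ) =
      (T ⊗ₖ (1 : Matrix B B ℂ)) * idTensor A Φ Y * (T ⊗ₖ (1 : Matrix B B ℂ))ᴴ := by
  ext p q
  rw [kronecker_one_conj_apply]
  have e : (Matrix.of fun a a' => ((T ⊗ₖ (1 : Matrix A A ℂ)) * Y *
      (T ⊗ₖ (1 : Matrix A A ℂ))ᴴ) (p.1, a) (q.1, a')) =
      ∑ s', ∑ s, (T p.1 s * star (T q.1 s')) • Matrix.of fun a a' => Y (s, a) (s', a') := by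
    ext a a'
    simp only [of_apply, kronecker_one_conj_apply, Matrix.sum_apply, Matrix.smul_apply, smul_eq_mul]
  change Φ _ p.2 q.2 = _
  rw [e]
  simp only [map_sum, map_smul, Matrix.sum_apply, Matrix.smul_apply, smul_eq_mul]
  rfl

theorem trB_omega : trB (vecMulVec (omegaVec A) (star (omegaVec A))) = 1 := by
  ext a a'
  simp [trB, vecMulVec_apply, omegaVec, Matrix.one_apply]

/-- For a positive definite weight `τ`, the decomposition of the Choi operator obtained from the
Jordan decomposition of `(id ⊗ Φ)` at the purification of `τ`. -/
theorem exists_decomposition_of_posDef {Φ : Matrix A A ℂ →ₗ[ℂ] Matrix B B ℂ} (hΦ : IsHermPres Φ)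
    {d : ℝ} (hd : ∀ X : Matrix (A × A) (A × A) ℂ, X.PosSemidef →
      traceNorm (idTensor A Φ X) ≤ d * X.trace.re)
    {τ : Matrix A A ℂ} (hτ : τ.PosDef) :
    ∃ P N : Matrix (A × B) (A × B) ℂ, P.PosSemidef ∧ N.PosSemidef ∧ choi Φ = P - N ∧
      (τ * trB (P + N)).trace.re ≤ d * τ.trace.re := by
  -- With `τ = Tᴴ T`, the vector `(T ⊗ 1)Ω` purifies `τ` up to transposition and has squared norm
  -- `Tr τ`. Since `T` is invertible, the Jordan parts of the output can be conjugated back to parts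
  -- of `J_Φ`.
  obtain ⟨T, hT⟩ := exists_eq_conjTranspose_mul_self hτ.posSemidef
  have hdet : IsUnit T.det := by
    have h1 := (Matrix.isUnit_iff_isUnit_det _).1 hτ.isUnit
    rw [hT, det_mul] at h1
    exact isUnit_of_mul_isUnit_right h1
  have hST : (T⁻¹ ⊗ₖ (1 : Matrix B B ℂ)) * (T ⊗ₖ (1 : Matrix B B ℂ)) = 1 := by
    rw [← mul_kronecker_mul, nonsing_inv_mul _ hdet, Matrix.one_mul, one_kronecker_one]
  have hTS : (T ⊗ₖ (1 : Matrix B B ℂ)) * (T⁻¹ ⊗ₖ (1 : Matrix B B ℂ)) = 1 := by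
    rw [← mul_kronecker_mul, mul_nonsing_inv _ hdet, Matrix.one_mul, one_kronecker_one]
  have hdA := hd _ ((posSemidef_vecMulVec_self_star (omegaVec A)).mul_mul_conjTranspose_same
    (T ⊗ₖ (1 : Matrix A A ℂ)))
  rw [idTensor_conj_kronecker, Matrix.trace_mul_comm, ← Matrix.mul_assoc,
    kronecker_one_conjTranspose_mul_self, ← hT,
    trace_kronecker_one_mul, trB_omega, Matrix.mul_one] at hdA
  change traceNorm ((T ⊗ₖ (1 : Matrix B B ℂ)) * choi Φ * (T ⊗ₖ (1 : Matrix B B ℂ))ᴴ) ≤ _ at hdA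
  set S := T ⊗ₖ (1 : Matrix B B ℂ) with hS
  set S' := T⁻¹ ⊗ₖ (1 : Matrix B B ℂ) with hS'
  have hherm : (S * choi Φ * Sᴴ).IsHermitian := isHermitian_mul_mul_conjTranspose _ hΦ.isHermitian_choi
  obtain ⟨P, N, hP, hN, hPN, htr⟩ := exists_jordan_decomposition hherm
  refine ⟨S' * P * S'ᴴ, S' * N * S'ᴴ, hP.mul_mul_conjTranspose_same _,
    hN.mul_mul_conjTranspose_same _, ?_, ?_⟩
  · rw [← Matrix.sub_mul, ← Matrix.mul_sub, ← hPN]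
    calc choi Φ = (S' * S) * choi Φ * (S' * S)ᴴ := by simp [hST]
      _ = _ := by simp only [conjTranspose_mul, Matrix.mul_assoc]
  · refine le_trans (le_of_eq ?_) hdA
    rw [htr, ← trace_kronecker_one_mul, hT, ← kronecker_one_conjTranspose_mul_self, ← Matrix.add_mul, ← Matrix.mul_add,
      Matrix.mul_assoc, Matrix.trace_mul_comm]
    congr 2
    calc S * (S' * (P + N) * S'ᴴ) * Sᴴ = (S * S') * (P + N) * (S * S')ᴴ := by
          simp only [conjTranspose_mul, Matrix.mul_assoc]
      _ = _ := by simp [hTS]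

/-- Every real functional agrees on Hermitian matrices with the trace pairing against a Hermitian
matrix. -/
theorem exists_isHermitian_trace_repr (f : Matrix A A ℂ →ₗ[ℝ] ℝ) :
    ∃ σ : Matrix A A ℂ, σ.IsHermitian ∧
      ∀ Y : Matrix A A ℂ, Y.IsHermitian → f Y = (σ * Y).trace.re := by
  -- Splitting `y = Re y + i Im y`, this entry is the coefficient whose product with `y` has real
  -- part `f` of the matrix unit scaled by `y`.
  let G : Matrix A A ℂ := Matrix.of fun j i =>
    (f (Matrix.single i j 1) : ℂ) - Complex.I * f (Matrix.single i j Complex.I)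
  have hG : ∀ Y, f Y = (G * Y).trace.re := by
    intro Y
    have h1 : (G * Y).trace = ∑ i, ∑ j, G j i * Y i j := by
      simp only [Matrix.trace, diag_apply, Matrix.mul_apply]
      exact Finset.sum_comm
    rw [h1, Complex.re_sum]
    conv_lhs => rw [matrix_eq_sum_single Y]
    rw [map_sum]
    refine Finset.sum_congr rfl fun i _ => ?_
    rw [map_sum, Complex.re_sum]
    refine Finset.sum_congr rfl fun j _ => ?_
    have h2 : Matrix.single i j (Y i j) = (Y i j).re • Matrix.single i j (1 : ℂ) +
        (Y i j).im • Matrix.single i j Complex.I := by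
      rw [Matrix.smul_single, Matrix.smul_single, ← Matrix.single_add]
      congr 1
      apply Complex.ext <;> simp
    rw [h2, map_add, map_smul, map_smul]
    simp [G]
    ring
  refine ⟨((1 / 2 : ℝ) : ℂ) • (G + Gᴴ), ?_, fun Y hY => ?_⟩
  · simp [IsHermitian, conjTranspose_smul, add_comm]
  · rw [hG, Matrix.smul_mul, trace_smul, smul_eq_mul, Complex.re_ofReal_mul, Matrix.add_mul,
      trace_add, Complex.add_re]
    have : (Gᴴ * Y).trace.re = (G * Y).trace.re := by
      have : Gᴴ * Y = (Y * G)ᴴ := by rw [conjTranspose_mul, hY.eq]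
      rw [this, trace_conjTranspose, Matrix.trace_mul_comm]
      simp
    rw [this]
    ring

/-- Strong duality for the diamond norm. -/
theorem exists_decomposition {Φ : Matrix A A ℂ →ₗ[ℂ] Matrix B B ℂ} (hΦ : IsHermPres Φ)
    {d d' : ℝ} (hd : ∀ X : Matrix (A × A) (A × A) ℂ, X.PosSemidef →
      traceNorm (idTensor A Φ X) ≤ d * X.trace.re) (hdd : d < d') :
    ∃ P N : Matrix (A × B) (A × B) ℂ, P.PosSemidef ∧ N.PosSemidef ∧ choi Φ = P - N ∧
      ((d' : ℂ) • 1 - trB (P + N)).PosSemidef := by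
  by_contra! hcon
  -- The slack `Q` makes `C` upward closed, which forces the separating functional to be positive.
  let C : Set (Matrix A A ℂ) := {Y | ∃ P N : Matrix (A × B) (A × B) ℂ, ∃ Q : Matrix A A ℂ,
    P.PosSemidef ∧ N.PosSemidef ∧ Q.PosSemidef ∧ choi Φ = P - N ∧ Y = trB (P + N) + Q}
  have hCconv : Convex ℝ C := by
    rintro _ ⟨P, N, Q, hP, hN, hQ, h, rfl⟩ _ ⟨P', N', Q', hP', hN', hQ', h', rfl⟩ a b ha hb hab
    have hab' : (a : ℂ) + b = 1 := by exact_mod_cast hab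
    have ha' : (0 : ℂ) ≤ a := by exact_mod_cast ha
    have hb' : (0 : ℂ) ≤ b := by exact_mod_cast hb
    refine ⟨(a : ℂ) • P + (b : ℂ) • P', (a : ℂ) • N + (b : ℂ) • N', (a : ℂ) • Q + (b : ℂ) • Q',
      (hP.smul ha').add (hP'.smul hb'), (hN.smul ha').add (hN'.smul hb'),
      (hQ.smul ha').add (hQ'.smul hb'), ?_, ?_⟩
    · calc choi Φ = ((a : ℂ) + b) • choi Φ := by rw [hab', one_smul]
        _ = (a : ℂ) • (P - N) + (b : ℂ) • (P' - N') := by rw [add_smul, ← h, ← h']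
        _ = _ := by simp only [smul_sub]; abel
    · have : ∀ (r : ℝ) (M : Matrix A A ℂ), r • M = (r : ℂ) • M := fun r M => by
        ext; simp
      simp only [this, trB_add, trB_smul, smul_add]
      abel
  have hCherm : ∀ Y ∈ C, Y.IsHermitian := by
    rintro _ ⟨P, N, Q, hP, hN, hQ, h, rfl⟩
    exact (trB_isHermitian (hP.add hN).isHermitian).add hQ.isHermitian
  -- The gap `d' - e` absorbs the passage to the closure of `C`; the gap `e - d` gives the final
  -- contradiction.
  obtain ⟨e, hde, hed⟩ := exists_between hdd
  have hherm1 : ∀ r : ℝ, ((r : ℂ) • (1 : Matrix A A ℂ)).IsHermitian := fun r => by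
    simp [IsHermitian, conjTranspose_smul]
  have hnot : (e : ℂ) • (1 : Matrix A A ℂ) ∉ closure C := by
    intro hmem
    have hcont : Continuous fun Y : Matrix A A ℂ =>
        ((Y - (e : ℂ) • 1)ᴴ * (Y - (e : ℂ) • 1)).trace.re := by fun_prop
    obtain ⟨Y, hY, hYC⟩ := mem_closure_iff.1 hmem _ (isOpen_lt hcont
      (continuous_const (y := (d' - e) ^ 2))) (by
        simpa using pow_pos (sub_pos.2 hed) 2)
    have h1 := smul_one_sub_posSemidef_of_trace ((hCherm Y hYC).sub (hherm1 e))
      (sub_nonneg.2 hed.le) (le_of_lt hY)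
    obtain ⟨P, N, Q, hP, hN, hQ, h, rfl⟩ := hYC
    refine hcon P N hP hN h ?_
    convert h1.add hQ using 1
    rw [Complex.ofReal_sub, sub_smul]
    abel
  have : LocallyConvexSpace ℝ (Matrix A A ℂ) :=
    inferInstanceAs (LocallyConvexSpace ℝ (A → A → ℂ))
  obtain ⟨f, u, hfe, hfC⟩ := geometric_hahn_banach_point_closed hCconv.closure isClosed_closure hnot
  obtain ⟨σ, hσ, hf⟩ := exists_isHermitian_trace_repr (f : Matrix A A ℂ →ₗ[ℝ] ℝ)
  change ∀ Y : Matrix A A ℂ, Y.IsHermitian → f Y = (σ * Y).trace.re at hf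
  have hlow : ∀ (P N : Matrix (A × B) (A × B) ℂ) (Q : Matrix A A ℂ), P.PosSemidef → N.PosSemidef →
      Q.PosSemidef → choi Φ = P - N → u < (σ * trB (P + N)).trace.re + (σ * Q).trace.re := by
    intro P N Q hP hN hQ h
    have hYC : trB (P + N) + Q ∈ C := ⟨P, N, Q, hP, hN, hQ, h, rfl⟩
    have := hfC _ (subset_closure hYC)
    rwa [hf _ (hCherm _ hYC), Matrix.mul_add, trace_add, Complex.add_re] at this
  have hσpos : σ.PosSemidef := by
    refine posSemidef_of_re_nonneg hσ fun v => ?_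
    obtain ⟨P, N, hP, hN, h, -⟩ := exists_jordan_decomposition hΦ.isHermitian_choi
    by_contra! hneg
    set q := (star v ⬝ᵥ (σ *ᵥ v)).re with hq
    set c := (σ * trB (P + N)).trace.re with hc
    -- This multiple of `vvᴴ` lowers the functional from `c` to `c - |c - u| - 1`, below the
    -- separating level `u`.
    have hs : 0 ≤ (|c - u| + 1) / (-q) := div_nonneg (by positivity) (by linarith)
    have hs' : (0 : ℂ) ≤ (((|c - u| + 1) / (-q) : ℝ) : ℂ) := by exact_mod_cast hs
    have h1 := hlow P N _ hP hN ((posSemidef_vecMulVec_self_star v).smul hs') h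
    rw [Matrix.mul_smul, trace_smul, smul_eq_mul, Complex.re_ofReal_mul, trace_vecMulVec_mul,
      ← hq, div_mul_eq_mul_div, div_neg, mul_div_assoc, div_self hneg.ne] at h1
    linarith [le_abs_self (c - u)]
  rw [hf _ (hherm1 e), Matrix.mul_smul, Matrix.mul_one, trace_smul, smul_eq_mul,
    Complex.re_ofReal_mul] at hfe
  -- `σ` may be singular, so it is perturbed to `σ + ε • 1`; the cost vanishes with `ε`.
  have hup : ∀ ε : ℝ, 0 < ε → u ≤ d * σ.trace.re + ε * (d * Fintype.card A) := by
    intro ε hε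
    have hε' : (0 : ℂ) < ε := by exact_mod_cast hε
    have hτ : (σ + (ε : ℂ) • 1).PosDef := PosDef.posSemidef_add hσpos (PosDef.one.smul hε')
    obtain ⟨P, N, hP, hN, h, hle⟩ := exists_decomposition_of_posDef hΦ hd hτ
    have h1 := hlow P N 0 hP hN PosSemidef.zero h
    have h2 := mul_nonneg hε.le (re_trace_nonneg (trB_posSemidef (hP.add hN)))
    simp only [Matrix.add_mul, Matrix.smul_mul, Matrix.one_mul, trace_add, trace_smul, trace_one,
      smul_eq_mul, Complex.add_re, Complex.re_ofReal_mul, Matrix.mul_zero, trace_zero,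
      Complex.zero_re, Complex.natCast_re] at h1 hle
    nlinarith
  have hu : u ≤ d * σ.trace.re := by
    by_contra! hlt
    set k := d * Fintype.card A with hk
    have hpos : 0 < (u - d * σ.trace.re) / (2 * (|k| + 1)) := by
      apply div_pos <;> [linarith; positivity]
    have h1 := hup _ hpos
    have h2 : (u - d * σ.trace.re) / (2 * (|k| + 1)) * k ≤ (u - d * σ.trace.re) / 2 := by
      rw [div_mul_eq_mul_div, div_le_div_iff₀ (by positivity) (by positivity)]
      nlinarith [le_abs_self k]
    linarith
  nlinarith [mul_le_mul_of_nonneg_right hde.le (re_trace_nonneg hσpos)]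

/-! ### Attainment of the diamond norm and the resulting CPTNI decomposition. -/

theorem isCompact_setOf_isDensity : IsCompact {ρ : Matrix A A ℂ | IsDensity ρ} := by
  refine isCompact_of_posSemidef_of_trace_le (c := 1) ?_ (fun M hM => hM.1)
    (fun M hM => by rw [hM.2]; simp)
  exact isClosed_posSemidef.inter (isClosed_eq (by fun_prop) continuous_const)

theorem exists_isDensity [Nonempty A] : ∃ ρ : Matrix A A ℂ, IsDensity ρ := by
  obtain ⟨a⟩ := ‹Nonempty A›
  refine ⟨vecMulVec (Pi.single a 1) (star (Pi.single a 1)), posSemidef_vecMulVec_self_star _, ?_⟩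
  rw [trace_vecMulVec]
  simp

theorem continuousOn_traceNorm_idTensor {Φ : Matrix A A ℂ →ₗ[ℂ] Matrix B B ℂ} (hΦ : IsHermPres Φ) :
    ContinuousOn (fun ρ => traceNorm (idTensor A Φ ρ))
      {ρ : Matrix (A × A) (A × A) ℂ | IsDensity ρ} := by
  intro ρ₀ h₀
  let g : Matrix (A × A) (A × A) ℂ → ℝ := fun ρ => Real.sqrt (Fintype.card (A × B) *
    ((idTensor A Φ (ρ - ρ₀))ᴴ * idTensor A Φ (ρ - ρ₀)).trace.re)
  have hL : Continuous (idTensor A Φ) := LinearMap.continuous_of_finiteDimensional _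
  have hg : Continuous g := by fun_prop
  have hg0 : g ρ₀ = 0 := by simp [g]
  have hle : ∀ {X Y : Matrix (A × A) (A × A) ℂ}, X.IsHermitian → Y.IsHermitian →
      traceNorm (idTensor A Φ X) ≤ traceNorm (idTensor A Φ Y) +
        traceNorm (idTensor A Φ (X - Y)) := by
    intro X Y hX hY
    have h := traceNorm_add_le (hΦ.isHermitian_idTensor hY) (hΦ.isHermitian_idTensor (hX.sub hY))
    rwa [← map_add, add_sub_cancel] at h
  refine tendsto_iff_dist_tendsto_zero.2 (squeeze_zero' (Filter.Eventually.of_forall fun _ =>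
    dist_nonneg) (g := g) ?_ ?_)
  · filter_upwards [self_mem_nhdsWithin] with ρ hρ
    have h1 := hle hρ.1.isHermitian h₀.1.isHermitian
    have h2 := hle h₀.1.isHermitian hρ.1.isHermitian
    have h3 := traceNorm_le_sqrt (idTensor A Φ (ρ - ρ₀))
    have h4 := traceNorm_le_sqrt (idTensor A Φ (ρ₀ - ρ))
    have e : ((idTensor A Φ (ρ₀ - ρ))ᴴ * idTensor A Φ (ρ₀ - ρ)) =
        (idTensor A Φ (ρ - ρ₀))ᴴ * idTensor A Φ (ρ - ρ₀) := by
      rw [← neg_sub ρ ρ₀, map_neg, conjTranspose_neg, neg_mul_neg]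
    rw [e] at h4
    rw [Real.dist_eq, abs_le]
    change traceNorm (idTensor A Φ (ρ - ρ₀)) ≤ g ρ at h3
    change traceNorm (idTensor A Φ (ρ₀ - ρ)) ≤ g ρ at h4
    constructor <;> linarith
  · rw [← hg0]
    exact hg.continuousWithinAt

theorem isGreatest_diamondNorm [Nonempty A] {Φ : Matrix A A ℂ →ₗ[ℂ] Matrix B B ℂ}
    (hΦ : IsHermPres Φ) : IsGreatest (diamondSet Φ) (diamondNorm Φ) := by
  have himg : diamondSet Φ = (fun ρ => traceNorm (idTensor A Φ ρ)) ''
      {ρ : Matrix (A × A) (A × A) ℂ | IsDensity ρ} := by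
    ext t
    exact ⟨fun ⟨ρ, h, e⟩ => ⟨ρ, h, e.symm⟩, fun ⟨ρ, h, e⟩ => ⟨ρ, h, e.symm⟩⟩
  have hc := isCompact_setOf_isDensity.image_of_continuousOn (continuousOn_traceNorm_idTensor hΦ)
  obtain ⟨ρ, hρ⟩ := exists_isDensity (A := A × A)
  obtain ⟨m, hm⟩ := hc.exists_isGreatest ⟨_, ρ, hρ, rfl⟩
  rw [← himg] at hm
  rw [diamondNorm, hm.csSup_eq]
  exact hm

theorem traceNorm_idTensor_le_diamondNorm_mul [Nonempty A] {Φ : Matrix A A ℂ →ₗ[ℂ] Matrix B B ℂ}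
    (hΦ : IsHermPres Φ) {X : Matrix (A × A) (A × A) ℂ} (hX : X.PosSemidef) :
    traceNorm (idTensor A Φ X) ≤ diamondNorm Φ * X.trace.re := by
  have him : X.trace = X.trace.re := by
    apply Complex.ext
    · simp
    · simpa using (Complex.le_def.1 hX.trace_nonneg).2.symm
  rcases (re_trace_nonneg hX).eq_or_lt with h0 | hpos
  · have hX0 : X = 0 := by
      ext i j
      simpa [← h0] using norm_apply_le_re_trace hX i j
    subst hX0
    simpa using traceNorm_le_sqrt (0 : Matrix (A × B) (A × B) ℂ)
  · have hpos' : (0 : ℂ) ≤ ((X.trace.re⁻¹ : ℝ) : ℂ) := by exact_mod_cast (inv_pos.2 hpos).le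
    have hne : (X.trace.re : ℂ) ≠ 0 := by exact_mod_cast hpos.ne'
    have hρ : IsDensity (((X.trace.re⁻¹ : ℝ) : ℂ) • X) := by
      refine ⟨hX.smul hpos', ?_⟩
      rw [trace_smul, smul_eq_mul, Complex.ofReal_inv]
      conv_lhs => rw [him]
      simp [hne]
    have h1 := (isGreatest_diamondNorm hΦ).2 ⟨_, hρ, rfl⟩
    have h2 := traceNorm_smul_le (hΦ.isHermitian_idTensor hρ.1.isHermitian) hpos.le
    rw [← map_smul, smul_smul, Complex.ofReal_inv, mul_inv_cancel₀ hne, one_smul] at h2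
    rw [Complex.ofReal_inv] at h1
    exact h2.trans (by rw [mul_comm]; exact mul_le_mul_of_nonneg_right h1 hpos.le)

theorem diamondNorm_nonneg [Nonempty A] {Φ : Matrix A A ℂ →ₗ[ℂ] Matrix B B ℂ}
    (hΦ : IsHermPres Φ) : 0 ≤ diamondNorm Φ := by
  obtain ⟨ρ, -, h⟩ := (isGreatest_diamondNorm hΦ).1
  exact h ▸ traceNorm_nonneg _

theorem diamondNorm_le [Nonempty A] {Φ : Matrix A A ℂ →ₗ[ℂ] Matrix B B ℂ} (hΦ : IsHermPres Φ)
    {P N : Matrix (A × B) (A × B) ℂ} (hP : P.PosSemidef) (hN : N.PosSemidef)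
    (hPN : choi Φ = P - N) {t : ℝ} (ht : ((t : ℂ) • 1 - trB (P + N)).PosSemidef) :
    diamondNorm Φ ≤ t := by
  obtain ⟨ρ, hρ, h⟩ := (isGreatest_diamondNorm hΦ).1
  rw [h]
  simpa [hρ.2] using traceNorm_idTensor_le hP hN hPN ht hρ.1

/-- Up to an arbitrarily small loss, a Hermiticity-preserving map is a difference of two multiples
of completely positive trace-non-increasing maps with weight its diamond norm. -/
theorem exists_isCPTNI_decomposition [Nonempty A] {Φ : Matrix A A ℂ →ₗ[ℂ] Matrix B B ℂ}
    (hΦ : IsHermPres Φ) {t : ℝ} (ht : diamondNorm Φ < t) :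
    ∃ L M : Matrix A A ℂ →ₗ[ℂ] Matrix B B ℂ, IsCPTNI L ∧ IsCPTNI M ∧
      Φ = (t : ℂ) • L - (t : ℂ) • M := by
  have ht0 : 0 < t := (diamondNorm_nonneg hΦ).trans_lt ht
  have hne : (t : ℂ) ≠ 0 := by exact_mod_cast ht0.ne'
  obtain ⟨P, N, hP, hN, hPN, h⟩ := exists_decomposition hΦ
    (fun X hX => traceNorm_idTensor_le_diamondNorm_mul hΦ hX) ht
  have hinv : (0 : ℂ) ≤ (t : ℂ)⁻¹ := by
    rw [← Complex.ofReal_inv]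
    exact_mod_cast (inv_pos.2 ht0).le
  -- `Tr_B P ≤ Tr_B (P + N) ≤ t • 1`, and likewise for `N` by symmetry.
  have key : ∀ {P N : Matrix (A × B) (A × B) ℂ}, P.PosSemidef → N.PosSemidef →
      ((t : ℂ) • 1 - trB (P + N)).PosSemidef → IsCPTNI (ofChoi ((t : ℂ)⁻¹ • P)) := by
    intro P N hP hN h
    rw [isCPTNI_iff, choi_ofChoi]
    refine ⟨hP.smul hinv, ?_⟩
    convert (h.add (trB_posSemidef hN)).smul hinv using 1
    rw [trB_add, trB_smul, smul_add, smul_sub, smul_smul, inv_mul_cancel₀ hne, one_smul, smul_add]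
    abel
  refine ⟨ofChoi ((t : ℂ)⁻¹ • P), ofChoi ((t : ℂ)⁻¹ • N), key hP hN h,
    key hN hP (by rwa [add_comm]), ?_⟩
  apply choi_injective
  rw [choi_sub, choi_smul, choi_smul, choi_ofChoi, choi_ofChoi, smul_smul, smul_smul,
    mul_inv_cancel₀ hne, one_smul, one_smul, hPN]

/-! ### Compactness and attainment of the minima. -/

theorem isLeast_sInf_of_isCompact_inter_Iic {S : Set ℝ} {x : ℝ} (hx : x ∈ S)
    (hS : IsCompact (S ∩ Set.Iic x)) : IsLeast S (sInf S) := by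
  obtain ⟨m, hm, hmin⟩ := hS.exists_isLeast ⟨x, hx, Set.mem_Iic.2 le_rfl⟩
  have h : IsLeast S m := ⟨hm.1, fun y hy => by
    rcases le_total y x with h | h
    · exact hmin ⟨hy, h⟩
    · exact hm.2.trans h⟩
  rwa [h.csInf_eq]

variable (A B) in
/-- The Choi operators of completely positive trace-non-increasing maps. -/
def choiCPTNI : Set (Matrix (A × B) (A × B) ℂ) :=
  {C | C.PosSemidef ∧ (1 - trB C).PosSemidef}

theorem isCompact_choiCPTNI : IsCompact (choiCPTNI A B) := by
  refine isCompact_of_posSemidef_of_trace_le (c := Fintype.card A) ?_ (fun M hM => hM.1)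
    fun M hM => ?_
  · exact isClosed_posSemidef.inter
      (isClosed_posSemidef.preimage (continuous_const.sub continuous_trB))
  · have := re_trace_nonneg hM.2
    rw [trace_sub, trace_trB, trace_one, Complex.sub_re, Complex.natCast_re] at this
    linarith

theorem choi_mem_choiCPTNI {L : Matrix A A ℂ →ₗ[ℂ] Matrix B B ℂ} (h : IsCPTNI L) :
    choi L ∈ choiCPTNI A B := isCPTNI_iff.1 h

theorem isCPTNI_ofChoi {C : Matrix (A × B) (A × B) ℂ} (h : C ∈ choiCPTNI A B) :
    IsCPTNI (ofChoi C) := isCPTNI_iff.2 (by rwa [choi_ofChoi])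

/-- Truncating at `T` bounds both weights, so the feasible values are a continuous image of a
compact set of weights and Choi operators. -/
theorem isCompact_baseSet_inter_Iic (Φ : Matrix A A ℂ →ₗ[ℂ] Matrix B B ℂ) (T : ℝ) :
    IsCompact (baseSet Φ ∩ Set.Iic T) := by
  have hK : IsCompact (((Set.Icc (0 : ℝ) T ×ˢ Set.Icc (0 : ℝ) T) ×ˢ
      (choiCPTNI A B ×ˢ choiCPTNI A B)) ∩
      ({p | choi Φ = (p.1.1 : ℂ) • p.2.1 - (p.1.2 : ℂ) • p.2.2} ∩ {p | p.1.1 + p.1.2 ≤ T})) := by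
    refine ((isCompact_Icc.prod isCompact_Icc).prod
      (isCompact_choiCPTNI.prod isCompact_choiCPTNI)).inter_right ?_
    exact (isClosed_eq continuous_const (by fun_prop)).inter
      (isClosed_le (by fun_prop) continuous_const)
  convert hK.image (f := fun p => p.1.1 + p.1.2)
    (continuous_fst.fst.add continuous_fst.snd) using 1
  ext t
  constructor
  · rintro ⟨⟨l, m, L, M, hl, hm, hL, hM, rfl, rfl⟩, hT⟩
    rw [Set.mem_Iic] at hT
    exact ⟨((l, m), choi L, choi M), ⟨⟨⟨⟨hl, by linarith⟩, hm, by linarith⟩,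
      choi_mem_choiCPTNI hL, choi_mem_choiCPTNI hM⟩, rfl, hT⟩, rfl⟩
  · rintro ⟨⟨⟨l, m⟩, C, D⟩, ⟨⟨⟨hl, hm⟩, hC, hD⟩, h, hT⟩, rfl⟩
    refine ⟨⟨l, m, ofChoi C, ofChoi D, hl.1, hm.1, isCPTNI_ofChoi hC, isCPTNI_ofChoi hD, ?_, rfl⟩,
      hT⟩
    apply choi_injective
    rw [choi_sub, choi_smul, choi_smul, choi_ofChoi, choi_ofChoi]
    exact h

theorem isCompact_robSet'_inter_Iic (Φ : Matrix A A ℂ →ₗ[ℂ] Matrix B B ℂ) (T : ℝ) :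
    IsCompact (robSet' Φ ∩ Set.Iic T) := by
  have hK : IsCompact ((Set.Icc (-1 : ℝ) T ×ˢ choiCPTNI A B) ∩
      {p | (((1 + p.1 : ℝ) : ℂ) • p.2 - choi Φ).PosSemidef}) :=
    (isCompact_Icc.prod isCompact_choiCPTNI).inter_right
      (isClosed_posSemidef.preimage (by fun_prop))
  convert hK.image (f := Prod.fst) continuous_fst using 1
  ext l
  constructor
  · rintro ⟨⟨hl, L, hL, h⟩, hT⟩
    exact ⟨(l, choi L), ⟨⟨⟨by linarith, hT⟩, choi_mem_choiCPTNI hL⟩, h⟩, rfl⟩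
  · rintro ⟨⟨l, C⟩, ⟨⟨hl, hC⟩, h⟩, rfl⟩
    refine ⟨⟨by linarith [hl.1], ofChoi C, isCPTNI_ofChoi hC, ?_⟩, hl.2⟩
    rw [choi_ofChoi]
    exact h

theorem isCompact_robSet''_inter_Iic (Φ : Matrix A A ℂ →ₗ[ℂ] Matrix B B ℂ) (T : ℝ) :
    IsCompact (robSet'' Φ ∩ Set.Iic T) := by
  have hK : IsCompact ((Set.Icc (0 : ℝ) T ×ˢ choiCPTNI A B) ∩
      {p | (choi Φ + (p.1 : ℂ) • p.2).PosSemidef}) :=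
    (isCompact_Icc.prod isCompact_choiCPTNI).inter_right
      (isClosed_posSemidef.preimage (by fun_prop))
  convert hK.image (f := Prod.fst) continuous_fst using 1
  ext l
  constructor
  · rintro ⟨⟨hl, L, hL, h⟩, hT⟩
    exact ⟨(l, choi L), ⟨⟨⟨hl, hT⟩, choi_mem_choiCPTNI hL⟩, isCP_iff.1 h⟩, rfl⟩
  · rintro ⟨⟨l, C⟩, ⟨⟨hl, hC⟩, h⟩, rfl⟩
    refine ⟨⟨hl.1, ofChoi C, isCPTNI_ofChoi hC, isCP_iff.2 ?_⟩, hl.2⟩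
    rw [choi_add, choi_smul, choi_ofChoi]
    exact h

/-! ### Extreme eigenvalues and the bounds on the three minima. -/

theorem sub_lamMin_posSemidef {M : Matrix A A ℂ} (hM : M.IsHermitian) :
    (M - (lamMin M : ℂ) • 1).PosSemidef := by
  have hle : ∀ i, lamMin M ≤ hM.eigenvalues i := fun i =>
    csInf_le (hM.spectrum_real_eq_range_eigenvalues ▸ (Set.finite_range _).bddBelow)
      (hM.eigenvalues_mem_spectrum_real i)
  have hU := Unitary.coe_mul_star_self hM.eigenvectorUnitary
  have h := hM.spectral_theorem
  rw [Unitary.conjStarAlgAut_apply] at h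
  set U : Matrix A A ℂ := (hM.eigenvectorUnitary).1
  have e : M - (lamMin M : ℂ) • 1 =
      U * diagonal (fun i => ((hM.eigenvalues i - lamMin M : ℝ) : ℂ)) * Uᴴ := by
    have : diagonal (fun i => ((hM.eigenvalues i - lamMin M : ℝ) : ℂ)) =
        diagonal (RCLike.ofReal ∘ hM.eigenvalues) - (lamMin M : ℂ) • (1 : Matrix A A ℂ) := by
      ext i j
      by_cases hij : i = j <;> simp [hij, diagonal]
    rw [this, Matrix.mul_sub, Matrix.sub_mul, Matrix.mul_smul, Matrix.mul_one, Matrix.smul_mul]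
    exact congrArg₂ _ h (congrArg _ hU.symm)
  rw [e]
  refine PosSemidef.mul_mul_conjTranspose_same (PosSemidef.diagonal fun i => ?_) U
  simp only [Pi.zero_apply]
  exact_mod_cast sub_nonneg.2 (hle i)

theorem lamMax_eq_neg_lamMin_neg (M : Matrix A A ℂ) : lamMax M = -lamMin (-M) := by
  rw [lamMax, lamMin, ← spectrum.neg_eq, Real.sInf_def, neg_neg, neg_neg]

theorem lamMax_sub_posSemidef {M : Matrix A A ℂ} (hM : M.IsHermitian) :
    ((lamMax M : ℂ) • 1 - M).PosSemidef := by
  have h := sub_lamMin_posSemidef hM.neg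
  rw [lamMax_eq_neg_lamMin_neg, Complex.ofReal_neg, neg_smul]
  convert h using 1
  abel

theorem baseSet_lower [Nonempty A] {Φ : Matrix A A ℂ →ₗ[ℂ] Matrix B B ℂ} (hΦ : IsHermPres Φ) :
    diamondNorm Φ ∈ lowerBounds (baseSet Φ) := by
  rintro t ⟨l, m, L, M, hl, hm, hL, hM, h, rfl⟩
  have hl' : (0 : ℂ) ≤ l := by exact_mod_cast hl
  have hm' : (0 : ℂ) ≤ m := by exact_mod_cast hm
  rw [isCPTNI_iff] at hL hM
  refine diamondNorm_le hΦ (hL.1.smul hl') (hM.1.smul hm')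
    (by rw [h, choi_sub, choi_smul, choi_smul]) ?_
  convert (hL.2.smul hl').add (hM.2.smul hm') using 1
  rw [trB_add, trB_smul, trB_smul, Complex.ofReal_add, add_smul, smul_sub, smul_sub]
  abel

/-- Take `P = (1 + l) J_L` and `N = P - J_Φ`: then `Tr_B (P + N) = 2 (1 + l) Tr_B J_L - Tr_B J_Φ`,
at most `2 (1 + l) - λ_min`. -/
theorem robSet'_lower [Nonempty A] {Φ : Matrix A A ℂ →ₗ[ℂ] Matrix B B ℂ} (hΦ : IsHermPres Φ) :
    (diamondNorm Φ - 2 + lamMin (trB (choi Φ))) / 2 ∈ lowerBounds (robSet' Φ) := by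
  rintro l ⟨hl, L, hL, h⟩
  have hl' : (0 : ℂ) ≤ ((1 + l : ℝ) : ℂ) := by exact_mod_cast hl
  rw [isCPTNI_iff] at hL
  have key := diamondNorm_le hΦ (t := 2 * (1 + l) - lamMin (trB (choi Φ))) (hL.1.smul hl') h
    (by abel) (by
      have h1 := hL.2.smul hl'
      convert (h1.add h1).add (sub_lamMin_posSemidef (trB_isHermitian hΦ.isHermitian_choi)) using 1
      rw [trB_add, trB_sub, trB_smul, smul_sub, Complex.ofReal_sub, Complex.ofReal_mul, sub_smul,
        Complex.ofReal_ofNat, two_mul, add_smul]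
      abel)
  linarith

/-- Take `N = l J_L` and `P = J_Φ + N`: then `Tr_B (P + N) = 2 l Tr_B J_L + Tr_B J_Φ`, at most `2 l
+ λ_max`. -/
theorem robSet''_lower [Nonempty A] {Φ : Matrix A A ℂ →ₗ[ℂ] Matrix B B ℂ} (hΦ : IsHermPres Φ) :
    (diamondNorm Φ - lamMax (trB (choi Φ))) / 2 ∈ lowerBounds (robSet'' Φ) := by
  rintro l ⟨hl, L, hL, h⟩
  have hl' : (0 : ℂ) ≤ l := by exact_mod_cast hl
  rw [isCPTNI_iff] at hL
  rw [isCP_iff, choi_add, choi_smul] at h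
  have key := diamondNorm_le hΦ (t := 2 * l + lamMax (trB (choi Φ))) h (hL.1.smul hl')
    (by abel) (by
      have h1 := hL.2.smul hl'
      convert (h1.add h1).add (lamMax_sub_posSemidef (trB_isHermitian hΦ.isHermitian_choi)) using 1
      rw [trB_add, trB_add, trB_smul, smul_sub, Complex.ofReal_add, Complex.ofReal_mul, add_smul,
        Complex.ofReal_ofNat, two_mul, add_smul]
      abel)
  linarith

theorem mem_baseSet [Nonempty A] {Φ : Matrix A A ℂ →ₗ[ℂ] Matrix B B ℂ} (hΦ : IsHermPres Φ) {t : ℝ}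
    (ht : diamondNorm Φ < t) : 2 * t ∈ baseSet Φ := by
  have ht0 : 0 ≤ t := (diamondNorm_nonneg hΦ).trans ht.le
  obtain ⟨L, M, hL, hM, h⟩ := exists_isCPTNI_decomposition hΦ ht
  exact ⟨t, t, L, M, ht0, ht0, hL, hM, h, two_mul t⟩

theorem mem_robSet' [Nonempty A] {Φ : Matrix A A ℂ →ₗ[ℂ] Matrix B B ℂ} (hΦ : IsHermPres Φ) {t : ℝ}
    (ht : diamondNorm Φ < t) : t - 1 ∈ robSet' Φ := by
  have ht0 : 0 ≤ t := (diamondNorm_nonneg hΦ).trans ht.le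
  have ht' : (0 : ℂ) ≤ t := by exact_mod_cast ht0
  obtain ⟨L, M, hL, hM, h⟩ := exists_isCPTNI_decomposition hΦ ht
  refine ⟨by linarith, L, hL, ?_⟩
  convert (isCPTNI_iff.1 hM).1.smul ht' using 1
  rw [h, choi_sub, choi_smul, choi_smul, add_sub_cancel]
  abel

theorem mem_robSet'' [Nonempty A] {Φ : Matrix A A ℂ →ₗ[ℂ] Matrix B B ℂ} (hΦ : IsHermPres Φ) {t : ℝ}
    (ht : diamondNorm Φ < t) : t ∈ robSet'' Φ := by
  have ht0 : 0 ≤ t := (diamondNorm_nonneg hΦ).trans ht.le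
  have ht' : (0 : ℂ) ≤ t := by exact_mod_cast ht0
  obtain ⟨L, M, hL, hM, h⟩ := exists_isCPTNI_decomposition hΦ ht
  refine ⟨ht0, M, hM, ?_⟩
  rw [h, sub_add_cancel, isCP_iff, choi_smul]
  exact (isCPTNI_iff.1 hL).1.smul ht'

end Duality

end QuantumMap

end

open QuantumMap

theorem corollary1 {A B : Type*} [Fintype A] [DecidableEq A] [Nonempty A]
    [Fintype B] [DecidableEq B]
    (Φ : Matrix A A ℂ →ₗ[ℂ] Matrix B B ℂ) (hΦ : QuantumMap.IsHermPres Φ) :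
    -- the maximum and the minima defining the four quantities are attained
    (IsGreatest (QuantumMap.diamondSet Φ) (QuantumMap.diamondNorm Φ) ∧
      IsLeast (QuantumMap.baseSet Φ) (QuantumMap.baseNorm Φ) ∧
      IsLeast (QuantumMap.robSet' Φ) (QuantumMap.rob' Φ) ∧
      IsLeast (QuantumMap.robSet'' Φ) (QuantumMap.rob'' Φ)) ∧
    -- base norm
    (QuantumMap.baseNorm Φ ≤ 2 * QuantumMap.diamondNorm Φ ∧
      QuantumMap.diamondNorm Φ ≤ QuantumMap.baseNorm Φ) ∧
    -- first robustness
    (QuantumMap.rob' Φ ≤ QuantumMap.diamondNorm Φ + 1 ∧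
      (QuantumMap.diamondNorm Φ - 2
        + QuantumMap.lamMin (QuantumMap.trB (QuantumMap.choi Φ))) / 2 ≤ QuantumMap.rob' Φ) ∧
    -- second robustness
    (QuantumMap.rob'' Φ ≤ QuantumMap.diamondNorm Φ ∧
      (QuantumMap.diamondNorm Φ
        - QuantumMap.lamMax (QuantumMap.trB (QuantumMap.choi Φ))) / 2 ≤ QuantumMap.rob'' Φ) := by
  have hlt : diamondNorm Φ < diamondNorm Φ + 1 := lt_add_one _
  have hbase : IsLeast (baseSet Φ) (baseNorm Φ) :=
    isLeast_sInf_of_isCompact_inter_Iic (mem_baseSet hΦ hlt) (isCompact_baseSet_inter_Iic Φ _)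
  have hrob' : IsLeast (robSet' Φ) (rob' Φ) :=
    isLeast_sInf_of_isCompact_inter_Iic (mem_robSet' hΦ hlt) (isCompact_robSet'_inter_Iic Φ _)
  have hrob'' : IsLeast (robSet'' Φ) (rob'' Φ) :=
    isLeast_sInf_of_isCompact_inter_Iic (mem_robSet'' hΦ hlt) (isCompact_robSet''_inter_Iic Φ _)
  refine ⟨⟨isGreatest_diamondNorm hΦ, hbase, hrob', hrob''⟩, ⟨?_, baseSet_lower hΦ hbase.1⟩,
    ⟨?_, robSet'_lower hΦ hrob'.1⟩, ?_, robSet''_lower hΦ hrob''.1⟩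
  -- Strong duality is available only strictly above the diamond norm, so `t` is let decrease to it.
  · have h : baseNorm Φ / 2 ≤ diamondNorm Φ := le_of_forall_gt_imp_ge_of_dense fun t ht => by
      linarith [hbase.2 (mem_baseSet hΦ ht)]
    linarith
  -- Taking `t = diamondNorm Φ + 1` already gives `rob' Φ ≤ diamondNorm Φ`, so no limit is needed
  -- here.
  · linarith [hrob'.2 (mem_robSet' hΦ hlt)]
  · exact le_of_forall_gt_imp_ge_of_dense fun t ht => hrob''.2 (mem_robSet'' hΦ ht)
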